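/- Let $E$ and $F$ be Banach spaces over $\mathbb{K}=\mathbb{R}$ or $\mathbb{C}$, and let $E\hat\otimes_\varepsilon F^*$ be the completion of the algebraic tensor product $E\otimes F^*$ under the norm $$\Big\|\sum_{i=1}^n e_i\otimes y_i^*\Big\|_\varepsilon=\sup\Big\{\Big|\sum_{i=1}^n e^*(e_i)\,y^{**}(y_i^*)\Big| : e^*\in E^*,\ y^{**}\in F^{**},\ \|e^*\|\le 1,\ \|y^{**}\|\le 1\Big\}.$$ A bounded linear operator $T\colon E\to F$ is called integral if the bilinear form $(e,y^*)\mapsto y^*(Te)$ on $E\times F^*$ determines an element of the dual $(E\hat\otimes_\varepsilon F^*)^*$; the norm of that element is the integral norm $\|T\|_{\mathrm{int}}$. Let $B(E^*)$ be the closed unit ball of $E^*$ with the weak* topology. A countably additive vector measure $m$ on the Borel sets of $B(E^*)$ is called regular if for every Borel set $A$ and every $\varepsilon>0$ there are a compact $K$ and an open $U$ with $K\subseteq A\subseteq U$ such that the semivariation of $m$ on $U\setminus K$ is less than $\varepsilon$; it is of bounded variation if its total variation $|m|(B(E^*))$ is finite. Let $T\colon E\to F$ be a bounded linear operator. Then $T$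 is integral if and only if there is a regular $F^{**}$-valued vector measure $m$ of bounded variation on the Borel $\sigma$-field of $B(E^*)$ such that, with $F$ regarded as a subspace of $F^{**}$, $$Te=\int_{B(E^*)}e^*(e)\,dm(e^*)\qquad\text{for every } e\in E .$$ Moreover, if $T$ is integral, then $m$ can be chosen so that in addition $|m|(B(E^*))=\|T\|_{\mathrm{int}}$. -/

import Mathlib

open MeasureTheory TensorProduct Set
open scoped ENNReal

noncomputable section

namespace GrothendieckIntegral

section InjectiveTensorProduct

variable (𝕜 : Type*) [RCLike 𝕜]
variable (E : Type*) [NormedAddCommGroup E] [NormedSpace 𝕜 E]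
variable (G : Type*) [NormedAddCommGroup G] [NormedSpace 𝕜 G]

/-- The linear functional `x ⊗ y ↦ x*(x) y*(y)` on the algebraic tensor product. -/
def pairFunctional (xs : StrongDual 𝕜 E) (ys : StrongDual 𝕜 G) : E ⊗[𝕜] G →ₗ[𝕜] 𝕜 :=
  TensorProduct.dualDistrib 𝕜 E G
    ((xs : E →ₗ[𝕜] 𝕜) ⊗ₜ[𝕜] (ys : G →ₗ[𝕜] 𝕜))

/-- Pairs of functionals in the product of the closed dual unit balls. -/
abbrev DualBallPairs : Type _ :=
  Metric.closedBall (0 : StrongDual 𝕜 E) 1 × Metric.closedBall (0 : StrongDual 𝕜 G) 1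

/-- The injective norm: the supremum of `|∑ x*(x_i) y*(y_i)|` over `‖x*‖, ‖y*‖ ≤ 1`. -/
def injNorm (t : E ⊗[𝕜] G) : ℝ :=
  ⨆ p : DualBallPairs 𝕜 E G, ‖pairFunctional 𝕜 E G p.1 p.2 t‖

variable {𝕜 E G}

theorem pairFunctional_tmul (xs : StrongDual 𝕜 E) (ys : StrongDual 𝕜 G) (x : E) (y : G) :
    pairFunctional 𝕜 E G xs ys (x ⊗ₜ[𝕜] y) = xs x * ys y := rfl

theorem injNorm_bddAbove (t : E ⊗[𝕜] G) :
    BddAbove (range fun p : DualBallPairs 𝕜 E G => ‖pairFunctional 𝕜 E G p.1 p.2 t‖) := by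
  suffices h : ∃ C, ∀ p : DualBallPairs 𝕜 E G, ‖pairFunctional 𝕜 E G p.1 p.2 t‖ ≤ C by
    obtain ⟨C, hC⟩ := h
    exact ⟨C, by rintro _ ⟨p, rfl⟩; exact hC p⟩
  induction t using TensorProduct.induction_on with
  | zero => exact ⟨0, fun p => by simp⟩
  | tmul x y =>
    refine ⟨‖x‖ * ‖y‖, fun p => ?_⟩
    have h1 : ‖(p.1 : StrongDual 𝕜 E)‖ ≤ 1 := mem_closedBall_zero_iff.1 p.1.2
    have h2 : ‖(p.2 : StrongDual 𝕜 G)‖ ≤ 1 := mem_closedBall_zero_iff.1 p.2.2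
    rw [pairFunctional_tmul, norm_mul]
    exact mul_le_mul ((p.1 : StrongDual 𝕜 E).le_of_opNorm_le h1 x |>.trans_eq (one_mul _))
      ((p.2 : StrongDual 𝕜 G).le_of_opNorm_le h2 y |>.trans_eq (one_mul _))
      (norm_nonneg _) (norm_nonneg _)
  | add s t hs ht =>
    obtain ⟨C, hC⟩ := hs
    obtain ⟨D, hD⟩ := ht
    refine ⟨C + D, fun p => ?_⟩
    rw [map_add]
    exact (norm_add_le _ _).trans (add_le_add (hC p) (hD p))

theorem le_injNorm (t : E ⊗[𝕜] G) (p : DualBallPairs 𝕜 E G) :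
    ‖pairFunctional 𝕜 E G p.1 p.2 t‖ ≤ injNorm 𝕜 E G t :=
  le_ciSup (injNorm_bddAbove t) p

theorem injNorm_le {t : E ⊗[𝕜] G} {C : ℝ}
    (h : ∀ p : DualBallPairs 𝕜 E G, ‖pairFunctional 𝕜 E G p.1 p.2 t‖ ≤ C) :
    injNorm 𝕜 E G t ≤ C :=
  haveI : Nonempty (DualBallPairs 𝕜 E G) := ⟨(⟨0, by simp⟩, ⟨0, by simp⟩)⟩
  ciSup_le h

theorem exists_smul_norm_le_one (f : StrongDual 𝕜 E) : ∃ c : 𝕜, c ≠ 0 ∧ ‖c • f‖ ≤ 1 := by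
  have hf : (0 : ℝ) < ‖f‖ + 1 := by positivity
  refine ⟨((‖f‖ + 1 : ℝ) : 𝕜)⁻¹, inv_ne_zero (by exact_mod_cast hf.ne'), ?_⟩
  rw [norm_smul, norm_inv, RCLike.norm_ofReal, abs_of_pos hf, inv_mul_le_one₀ hf]
  linarith

/-- The dual unit balls separate the algebraic tensor product. -/
theorem eq_zero_of_injNorm_eq_zero (t : E ⊗[𝕜] G) (h : injNorm 𝕜 E G t = 0) : t = 0 := by
  have hball : ∀ p : DualBallPairs 𝕜 E G, pairFunctional 𝕜 E G p.1 p.2 t = 0 := fun p =>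
    norm_le_zero_iff.1 ((le_injNorm t p).trans_eq h)
  have hall : ∀ (xs : StrongDual 𝕜 E) (ys : StrongDual 𝕜 G),
      pairFunctional 𝕜 E G xs ys t = 0 := by
    intro xs ys
    obtain ⟨c, hc, hc1⟩ := exists_smul_norm_le_one xs
    obtain ⟨d, hd, hd1⟩ := exists_smul_norm_le_one ys
    have := hball (⟨c • xs, mem_closedBall_zero_iff.2 hc1⟩, ⟨d • ys, mem_closedBall_zero_iff.2 hd1⟩)
    have e : pairFunctional 𝕜 E G (c • xs) (d • ys) t = c * d * pairFunctional 𝕜 E G xs ys t := by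
      have e0 : pairFunctional 𝕜 E G (c • xs) (d • ys) = (c * d) • pairFunctional 𝕜 E G xs ys := by
        refine TensorProduct.ext' fun x y => ?_
        simp only [pairFunctional_tmul, LinearMap.smul_apply, _root_.smul_apply,
          smul_eq_mul]
        ring
      rw [e0, LinearMap.smul_apply, smul_eq_mul]
    rw [e] at this
    simpa [hc, hd] using this
  let b := Module.Free.chooseBasis 𝕜 E
  obtain ⟨g, rfl⟩ := (TensorProduct.equivFinsuppOfBasisLeft (N := G) b).symm.surjective t
  suffices hg : g = 0 by simp [hg]
  ext i
  refine (SeparatingDual.eq_zero_iff_forall_dual_eq_zero (R := 𝕜) _).2 fun ys => ?_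
  have hz : (g.sum fun j y => ys y • b j) = 0 := by
    refine (SeparatingDual.eq_zero_iff_forall_dual_eq_zero (R := 𝕜) _).2 fun xs => ?_
    have := hall xs ys
    rw [TensorProduct.equivFinsuppOfBasisLeft_symm_apply] at this
    simpa [Finsupp.sum, map_sum, pairFunctional_tmul, mul_comm] using this
  have hli := linearIndependent_iff.1 b.linearIndependent (g.mapRange ys (map_zero ys)) (by
    rw [Finsupp.linearCombination_apply, Finsupp.sum_mapRange_index (by simp)]
    exact hz)
  simpa using DFunLike.congr_fun hli i

theorem injNorm_smul_le (c : 𝕜) (t : E ⊗[𝕜] G) :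
    injNorm 𝕜 E G (c • t) ≤ ‖c‖ * injNorm 𝕜 E G t := injNorm_le fun p => by
  rw [map_smul, norm_smul]
  exact mul_le_mul_of_nonneg_left (le_injNorm t p) (norm_nonneg c)

variable (𝕜 E G)

/-- The injective norm as a group norm. -/
def injGroupNorm : AddGroupNorm (E ⊗[𝕜] G) where
  toFun := injNorm 𝕜 E G
  map_zero' := le_antisymm (injNorm_le fun p => by simp)
    (Real.iSup_nonneg fun _ => norm_nonneg _)
  add_le' s t := injNorm_le fun p => by
    rw [map_add]
    exact (norm_add_le _ _).trans (add_le_add (le_injNorm s p) (le_injNorm t p))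
  neg' t := by simp [injNorm]
  eq_zero_of_map_eq_zero' := eq_zero_of_injNorm_eq_zero

/-- `E ⊗_ε G`: the algebraic tensor product endowed with the injective norm. -/
def InjTensor : Type _ := E ⊗[𝕜] G

instance : NormedAddCommGroup (InjTensor 𝕜 E G) :=
  AddGroupNorm.toNormedAddCommGroup (E := E ⊗[𝕜] G) (injGroupNorm 𝕜 E G)

instance : NormedSpace 𝕜 (InjTensor 𝕜 E G) where
  __ := (inferInstanceAs (Module 𝕜 (E ⊗[𝕜] G)) : Module 𝕜 (E ⊗[𝕜] G))
  norm_smul_le c t := injNorm_smul_le c t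

/-- The elementary tensor `x ⊗ y` as an element of `E ⊗_ε G`. -/
def InjTensor.tmul (x : E) (y : G) : InjTensor 𝕜 E G := x ⊗ₜ[𝕜] y

/-- The injective tensor product: the completion of `E ⊗_ε G`. -/
abbrev InjTensorCompletion : Type _ := UniformSpace.Completion (InjTensor 𝕜 E G)

theorem InjTensor.norm_def (t : InjTensor 𝕜 E G) : ‖t‖ = injNorm 𝕜 E G t := rfl

end InjectiveTensorProduct

section IntegralOperator

variable {𝕜 : Type*} [RCLike 𝕜]
variable {E : Type*} [NormedAddCommGroup E] [NormedSpace 𝕜 E]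
variable {F : Type*} [NormedAddCommGroup F] [NormedSpace 𝕜 F]

/-- `φ` is the element of the dual of the injective tensor product of `E` and `F*` that is
determined by the bilinear form `(e, y*) ↦ y*(T e)`. -/
def IsInducedFunctional (T : E →L[𝕜] F)
    (φ : StrongDual 𝕜 (InjTensorCompletion 𝕜 E (StrongDual 𝕜 F))) : Prop :=
  ∀ (e : E) (ys : StrongDual 𝕜 F),
    φ (InjTensor.tmul 𝕜 E (StrongDual 𝕜 F) e ys : InjTensorCompletion 𝕜 E (StrongDual 𝕜 F))
      = ys (T e)

/-- Integral operators in the sense of Grothendieck. -/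
def IsIntegralOperator (T : E →L[𝕜] F) : Prop :=
  ∃ φ : StrongDual 𝕜 (InjTensorCompletion 𝕜 E (StrongDual 𝕜 F)), IsInducedFunctional T φ

theorem IsInducedFunctional.unique {T : E →L[𝕜] F}
    {φ ψ : StrongDual 𝕜 (InjTensorCompletion 𝕜 E (StrongDual 𝕜 F))}
    (hφ : IsInducedFunctional T φ) (hψ : IsInducedFunctional T ψ) : φ = ψ := by
  ext z
  refine UniformSpace.Completion.induction_on z (isClosed_eq φ.continuous ψ.continuous) fun t => ?_
  change E ⊗[𝕜] StrongDual 𝕜 F at t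
  let c : InjTensor 𝕜 E (StrongDual 𝕜 F) →L[𝕜] InjTensorCompletion 𝕜 E (StrongDual 𝕜 F) :=
    UniformSpace.Completion.toComplL
  change φ (c t) = ψ (c t)
  induction t using TensorProduct.induction_on with
  | zero => exact (map_zero (φ ∘L c)).trans (map_zero (ψ ∘L c)).symm
  | tmul e ys => exact (hφ e ys).trans (hψ e ys).symm
  | add s t hs ht =>
    exact (map_add (φ ∘L c) s t).trans
      ((congrArg₂ (· + ·) hs ht).trans (map_add (ψ ∘L c) s t).symm)

/-- The integral norm: the norm of the induced functional (which is unique). -/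
def integralNorm (T : E →L[𝕜] F) (hT : IsIntegralOperator T) : ℝ := ‖hT.choose‖

theorem integralNorm_eq {T : E →L[𝕜] F} (hT : IsIntegralOperator T)
    {φ : StrongDual 𝕜 (InjTensorCompletion 𝕜 E (StrongDual 𝕜 F))}
    (hφ : IsInducedFunctional T φ) : integralNorm T hT = ‖φ‖ := by
  rw [integralNorm, hT.choose_spec.unique hφ]

end IntegralOperator

section RepresentingMeasure

variable (𝕜 : Type*) [RCLike 𝕜]
variable (E : Type*) [NormedAddCommGroup E] [NormedSpace 𝕜 E]

/-- The closed unit ball `B(E*)` of the dual of `E`. -/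
def DualBall : Type _ :=
  ↥(WeakDual.toStrongDual ⁻¹' Metric.closedBall (0 : StrongDual 𝕜 E) 1 : Set (WeakDual 𝕜 E))

/-- The unit ball `B(E*)` carries the weak* topology. -/
instance : TopologicalSpace (DualBall 𝕜 E) := instTopologicalSpaceSubtype

/-- The Borel `σ`-field of the weak* topology. -/
instance : MeasurableSpace (DualBall 𝕜 E) := borel _

instance : BorelSpace (DualBall 𝕜 E) := ⟨rfl⟩

variable {𝕜 E}

/-- The value `e*(e)` of a functional `e*` in the dual ball. -/
def DualBall.eval (es : DualBall 𝕜 E) (e : E) : 𝕜 := es.1 e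

end RepresentingMeasure

section VectorMeasures

/-- Countably additive vector measures with values in a normed space, for the norm topology. -/
abbrev NormedVectorMeasure (X : Type*) [MeasurableSpace X] (V : Type*) [NormedAddCommGroup V] :
    Type _ :=
  VectorMeasure X V

variable {X : Type*} [MeasurableSpace X] {V : Type*} [NormedAddCommGroup V]

/-- The total variation `|m|(X)`. -/
def totalVariation (m : NormedVectorMeasure X V) : ℝ≥0∞ := m.variation univ

/-- A vector measure is of bounded variation if its total variation is finite. -/
def HasBoundedVariation (m : NormedVectorMeasure X V) : Prop := totalVariation m < ∞

/-- A vector measure on the Borel sets is regular if every Borel set can be enclosed between a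
compact set and an open set whose difference has arbitrarily small semivariation. -/
def IsRegularVectorMeasure [TopologicalSpace X] [NormedSpace ℝ V]
    (m : NormedVectorMeasure X V) : Prop :=
  ∀ A : Set X, MeasurableSet A → ∀ ε : ℝ≥0∞, 0 < ε →
    ∃ K U : Set X, IsCompact K ∧ IsOpen U ∧ K ⊆ A ∧ A ⊆ U ∧ m.semivariation (U \ K) < ε

/-- The integral `∫ f dm ∈ V` of a scalar function with respect to a `V`-valued measure, that is,
the extension of `1_A • c ↦ c • m(A)` to the functions integrable with respect to `|m|`. -/
def scalarIntegral {𝕜 : Type*} [RCLike 𝕜] [NormedSpace ℝ V] [NormedSpace 𝕜 V]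
    [IsScalarTower ℝ 𝕜 V] (m : NormedVectorMeasure X V) (f : X → 𝕜) : V :=
  m.integral f (ContinuousLinearMap.lsmul ℝ 𝕜)

end VectorMeasures

section Representation

variable {𝕜 : Type*} [RCLike 𝕜]
variable {E : Type*} [NormedAddCommGroup E] [NormedSpace 𝕜 E]
variable {F : Type*} [NormedAddCommGroup F] [NormedSpace 𝕜 F]

/-- `T e = ∫ e*(e) dm(e*)` for every `e`, where `T e` is regarded as an element of `F**`. -/
def Represents (m : NormedVectorMeasure (DualBall 𝕜 E) (StrongDual 𝕜 (StrongDual 𝕜 F)))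
    (T : E →L[𝕜] F) : Prop :=
  ∀ e : E, NormedSpace.inclusionInDoubleDual 𝕜 F (T e) =
    scalarIntegral m (fun es : DualBall 𝕜 E => es.eval e)

end Representation

end GrothendieckIntegral

end

/-! A tensor t = ∑ e_i ⊗ y_i in E ⊗ F* is viewed as the continuous function e* ↦ ∑ e*(e_i) y_i from
B(E*) to F*; by Hahn–Banach its sup norm is the injective norm of t.

If T is integral with functional φ, then |φ(t)| ≤ ‖φ‖ sup ‖t(e*)‖. A Pietsch-type domination
argument (`exists_regular_measure_le_integral`) replaces the supremum by integration against one
regular measure μ of mass at most ‖φ‖, so φ is a contraction for the norm of L¹(μ; F*). Its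
extension Ψ to that space gives a contraction R : L¹(μ) → F**, R(f)(y*) = Ψ(f y*), and m(A) = R(1_A)
represents T. Since |m| ≤ μ, m inherits regularity and has variation at most ‖φ‖
(`exists_vectorMeasure_of_norm_le_integral`). No Radon–Nikodym property is needed.

Conversely, pairing t(e*) with a representing m recovers the form on tensors, bounded by |m|(B(E*))
times the injective norm (`Represents.norm_tensorForm_le`). This yields integrality, and also the
reverse inequality between the norms. -/

noncomputable section

namespace GrothendieckIntegral

/-! ### Replacing a supremum by an integral -/

section Domination

open CompactlySupported

variable {X : Type*} [TopologicalSpace X] [CompactSpace X] [T2Space X] [MeasurableSpace X]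
  [BorelSpace X]

/-- A linear functional dominated by `C` times the supremum of a sublinear family of nonnegative
continuous functions on a compact space is dominated by the integral of this family against a
regular measure of mass at most `C`. -/
theorem exists_regular_measure_le_integral {V : Type*} [AddCommGroup V] [Module ℝ V]
    (N : V → X → ℝ) (N_cont : ∀ t, Continuous (N t))
    (N_add : ∀ s t x, N (s + t) x ≤ N s x + N t x)
    (N_smul : ∀ c : ℝ, 0 ≤ c → ∀ t x, N (c • t) x = c * N t x)
    (ℓ : V →ₗ[ℝ] ℝ) {C : ℝ} (hℓ : ∀ t r, 0 ≤ r → (∀ x, N t x ≤ r) → ℓ t ≤ C * r) :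
    ∃ μ : Measure X, μ.Regular ∧ IsFiniteMeasure μ ∧ μ univ ≤ ENNReal.ofReal C ∧
      ∀ t, ℓ t ≤ ∫ x, N t x ∂μ := by
  have N_zero : ∀ x, N 0 x = 0 := fun x => by simpa using N_smul 0 le_rfl 0 x
  let toCc (f : X → ℝ) (hf : Continuous f) : C_c(X, ℝ) :=
    ⟨⟨f, hf⟩, HasCompactSupport.of_compactSpace f⟩
  -- The cone is chosen so that a functional (h, b) ↦ Λ h + b nonnegative on it encodes all
  -- requirements at once: Λ is positive, Λ 1 ≤ C and ℓ t ≤ Λ (N t).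
  let s : PointedCone ℝ (C_c(X, ℝ) × ℝ) :=
    { carrier := {p | ∃ t r, 0 ≤ r ∧ (∀ x, N t x - r ≤ p.1 x) ∧ C * r - ℓ t ≤ p.2}
      zero_mem' := ⟨0, 0, le_rfl, by simp [N_zero], by simp⟩
      add_mem' := by
        rintro p q ⟨t, r, hr, h1, h2⟩ ⟨t', r', hr', h1', h2'⟩
        refine ⟨t + t', r + r', add_nonneg hr hr', fun x => ?_, ?_⟩
        · have := N_add t t' x
          have := h1 x
          have := h1' x
          simp only [Prod.fst_add, CompactlySupportedContinuousMap.coe_add, Pi.add_apply]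
          linarith
        · rw [map_add, Prod.snd_add]
          linarith
      smul_mem' := by
        rintro ⟨c, hc⟩ p ⟨t, r, hr, h1, h2⟩
        refine ⟨c • t, c * r, mul_nonneg hc hr, fun x => ?_, ?_⟩
        · have := mul_le_mul_of_nonneg_left (h1 x) hc
          rw [N_smul c hc]
          change _ ≤ c * p.1 x
          linarith
        · have := mul_le_mul_of_nonneg_left h2 hc
          rw [map_smul, smul_eq_mul]
          change _ ≤ c * p.2
          linarith }
  have hne : ((0, 1) : C_c(X, ℝ) × ℝ) ≠ 0 := fun h => one_ne_zero (congrArg Prod.snd h)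
  -- Start from (0, a) ↦ a. Positivity on the cone is exactly `hℓ`; cofinality holds because h is
  -- bounded below, so t = 0 and r = |D| serve as witnesses.
  obtain ⟨g, hg1, hg2⟩ := riesz_extension s (LinearPMap.mkSpanSingleton (0, 1) (1 : ℝ) hne) (by
      rintro ⟨p, hp⟩ ⟨t, r, hr, h1, h2⟩
      obtain ⟨a, rfl⟩ := Submodule.mem_span_singleton.1 hp
      refine le_of_le_of_eq ?_ (LinearPMap.mkSpanSingleton'_apply _ _ _ a hp).symm
      have := hℓ t r hr fun x => by simpa using h1 x
      simp only [Prod.smul_mk, smul_eq_mul, mul_one, RingHom.id_apply] at h2 ⊢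
      linarith) (by
      rintro ⟨h, b⟩
      obtain ⟨D, hD⟩ := (isCompact_range h.continuous).bddBelow
      refine ⟨⟨(C * |D| - b) • (0, 1), Submodule.mem_span_singleton.2 ⟨_, rfl⟩⟩,
        0, |D|, abs_nonneg D, fun x => ?_, ?_⟩
      · have : D ≤ h x := hD (mem_range_self x)
        have := neg_abs_le D
        simp [N_zero]
        linarith
      · simp)
  have hg_snd : ∀ a : ℝ, g (0, a) = a := fun a => by
    have h := (hg1 ⟨a • (0, 1), Submodule.mem_span_singleton.2 ⟨_, rfl⟩⟩).trans
      (LinearPMap.mkSpanSingleton'_apply _ _ _ a _)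
    simpa using h
  have hg_split : ∀ h a, g (h, a) = g (h, 0) + a := fun h a => by
    rw [← hg_snd a, ← map_add]
    simp [hg_snd]
  let Λ : C_c(X, ℝ) →ₚ[ℝ] ℝ := PositiveLinearMap.mk₀ (g ∘ₗ LinearMap.inl ℝ _ ℝ) fun h hh =>
    hg2 _ ⟨0, 0, le_rfl, fun x => by simpa [N_zero] using hh x, by simp⟩
  have hint : ∀ f hf, ∫ x, f x ∂(RealRMK.rieszMeasure Λ) = g (toCc f hf, 0) := fun f hf =>
    RealRMK.integral_rieszMeasure Λ (toCc f hf)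
  refine ⟨RealRMK.rieszMeasure Λ, inferInstance, inferInstance, ?_, fun t => ?_⟩
  -- The cone element (-1, C), with t = 0 and r = 1, bounds the mass.
  · have h1 := hg2 (-toCc (fun _ => 1) continuous_const, C)
      ⟨0, 1, zero_le_one, fun x => by simp [N_zero, toCc], by simp⟩
    have h2 : g (-toCc (fun _ => 1) continuous_const, 0) =
        - g (toCc (fun _ => 1) continuous_const, 0) := by
      rw [← map_neg]; simp
    rw [hg_split, h2, ← hint] at h1
    rw [← ENNReal.ofReal_toReal (measure_ne_top (RealRMK.rieszMeasure Λ) univ)]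
    refine ENNReal.ofReal_le_ofReal ?_
    simp [Measure.real] at h1
    linarith
  -- The cone element (N t, -ℓ t), with r = 0, gives the domination.
  · have h1 := hg2 (toCc (N t) (N_cont t), - ℓ t)
      ⟨t, 0, le_rfl, fun x => by simp [toCc], by simp⟩
    rw [hg_split] at h1
    rw [hint _ (N_cont t)]
    linarith

end Domination

/-! ### Extension of a dominated functional -/

section HahnBanach

/-- A linear functional dominated by `‖J ·‖` factors through `J` and a functional of norm at most
one. -/
theorem exists_dual_comp_eq {𝕜 : Type*} [RCLike 𝕜] {V W : Type*} [AddCommGroup V] [Module 𝕜 V]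
    [NormedAddCommGroup W] [NormedSpace 𝕜 W] (J : V →ₗ[𝕜] W) (φ : V →ₗ[𝕜] 𝕜)
    (h : ∀ t, ‖φ t‖ ≤ ‖J t‖) : ∃ Ψ : StrongDual 𝕜 W, ‖Ψ‖ ≤ 1 ∧ ∀ t, Ψ (J t) = φ t := by
  have hker : LinearMap.ker J ≤ LinearMap.ker φ := fun t ht => by
    simpa [LinearMap.mem_ker.1 ht] using h t
  let f : LinearMap.range J →ₗ[𝕜] 𝕜 :=
    (LinearMap.ker J).liftQ φ hker ∘ₗ (J.quotKerEquivRange.symm : LinearMap.range J →ₗ[𝕜] _)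
  have hf : ∀ t, f ⟨J t, LinearMap.mem_range_self J t⟩ = φ t := fun t => by
    have : J.quotKerEquivRange.symm ⟨J t, LinearMap.mem_range_self J t⟩ =
        (LinearMap.ker J).mkQ t := by
      rw [LinearEquiv.symm_apply_eq]
      rfl
    simp [f, this]
  obtain ⟨g, hg1, hg2⟩ := Module.Dual.exists_extension_of_le_seminorm (LinearMap.range J) f
    (p := normSeminorm 𝕜 W) (by
      rintro ⟨_, t, rfl⟩
      rw [hf]
      exact h t)
  refine ⟨g.mkContinuous 1 fun x => by simpa using hg2 x,
    LinearMap.mkContinuous_norm_le _ zero_le_one _, fun t => ?_⟩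
  exact (hg1 ⟨J t, LinearMap.mem_range_self J t⟩).trans (hf t)

end HahnBanach

/-! ### Vector measures induced by contractions on L¹(μ) -/

section VectorMeasureOfL1

variable {X : Type*} [MeasurableSpace X] {V : Type*} [NormedAddCommGroup V]

/-- Semivariation is at most variation, hence at most μ, so the inner and outer approximations of A
for μ also work for m. -/
theorem isRegularVectorMeasure_of_variation_le [TopologicalSpace X] [BorelSpace X]
    [T2Space X] [NormedSpace ℝ V] {m : NormedVectorMeasure X V} {μ : Measure X} [μ.Regular]
    [IsFiniteMeasure μ] (h : m.variation ≤ μ) : IsRegularVectorMeasure m := by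
  intro A hA ε hε
  obtain ⟨U, hAU, hU, hμU⟩ := hA.exists_isOpen_sdiff_lt (measure_ne_top μ A)
    (ENNReal.half_pos hε.ne').ne'
  obtain ⟨K, hKA, hK, hμK⟩ := hA.exists_isCompact_sdiff_lt (measure_ne_top μ A)
    (ENNReal.half_pos hε.ne').ne'
  refine ⟨K, U, hK, hU, hKA, hAU, ?_⟩
  calc m.semivariation (U \ K) ≤ m.variation (U \ K) := m.semivariation_le_variation
    _ ≤ μ (U \ K) := h _
    _ ≤ μ ((U \ A) ∪ (A \ K)) := measure_mono fun x hx => by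
      by_cases hxA : x ∈ A
      exacts [Or.inr ⟨hxA, hx.2⟩, Or.inl ⟨hx.1, hxA⟩]
    _ ≤ μ (U \ A) + μ (A \ K) := measure_union_le _ _
    _ < ε / 2 + ε / 2 := ENNReal.add_lt_add hμU.2 hμK
    _ = ε := ENNReal.add_halves ε

variable {𝕜 : Type*} [RCLike 𝕜] [NormedSpace 𝕜 V]
  {μ : Measure X} [IsFiniteMeasure μ]

theorem enorm_apply_indicatorConstLp_le (R : Lp 𝕜 1 μ →L[𝕜] V) (hR : ‖R‖ ≤ 1) {A : Set X}
    (hA : MeasurableSet A) :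
    ‖R (indicatorConstLp 1 hA (measure_ne_top μ A) (1 : 𝕜))‖ₑ ≤ μ A := by
  have h := R.le_of_opNorm_le hR (indicatorConstLp 1 hA (measure_ne_top μ A) (1 : 𝕜))
  rw [one_mul, norm_indicatorConstLp one_ne_zero ENNReal.one_ne_top] at h
  rw [← ofReal_norm, ← ENNReal.ofReal_toReal (measure_ne_top μ A)]
  exact ENNReal.ofReal_le_ofReal (by simpa using! h)

open Classical in
/-- The vector measure `A ↦ R 1_A` induced by a contraction `R : L¹(μ) → V`. -/
def vectorMeasureOfL1 (R : Lp 𝕜 1 μ →L[𝕜] V) (hR : ‖R‖ ≤ 1) : NormedVectorMeasure X V :=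
  VectorMeasure.of_additive_of_le_measure (μ := μ)
    (fun A => if hA : MeasurableSet A then
      R (indicatorConstLp 1 hA (measure_ne_top μ A) (1 : 𝕜)) else 0)
    (fun A => by
      split_ifs with hA
      · exact enorm_apply_indicatorConstLp_le R hR hA
      · simp)
    (fun A B hA hB hAB => by
      rw [dif_pos (hA.union hB), dif_pos hA, dif_pos hB, ← map_add,
        indicatorConstLp_disjoint_union hA hB (measure_ne_top μ A) (measure_ne_top μ B) hAB])
    (fun A hA => dif_neg hA)

theorem vectorMeasureOfL1_apply (R : Lp 𝕜 1 μ →L[𝕜] V) (hR : ‖R‖ ≤ 1) {A : Set X}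
    (hA : MeasurableSet A) :
    vectorMeasureOfL1 R hR A = R (indicatorConstLp 1 hA (measure_ne_top μ A) (1 : 𝕜)) :=
  dif_pos hA

theorem variation_vectorMeasureOfL1_le (R : Lp 𝕜 1 μ →L[𝕜] V) (hR : ‖R‖ ≤ 1) :
    (vectorMeasureOfL1 R hR).variation ≤ μ := by
  refine VectorMeasure.variation_le_of_forall_enorm_le fun A hA => ?_
  rw [vectorMeasureOfL1_apply R hR hA]
  exact enorm_apply_indicatorConstLp_le R hR hA

theorem scalarIntegral_vectorMeasureOfL1 [CompleteSpace V] [NormedSpace ℝ V] [IsScalarTower ℝ 𝕜 V]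
    (R : Lp 𝕜 1 μ →L[𝕜] V) (hR : ‖R‖ ≤ 1) {f : X → 𝕜} (hf : Integrable f μ) :
    scalarIntegral (vectorMeasureOfL1 R hR) f = R (hf.toL1 f) := by
  set m := vectorMeasureOfL1 R hR with hm
  have hle : m.variation ≤ μ := variation_vectorMeasureOfL1_le R hR
  -- The integral is built over |m|. As |m| ≤ μ, the same set function extends to L¹(μ) with the
  -- same values, and there it can be compared with R on indicators and by density.
  have hT : DominatedFinMeasAdditive μ (m.transpose (ContinuousLinearMap.lsmul ℝ 𝕜))
      ‖ContinuousLinearMap.lsmul ℝ 𝕜 (E := V)‖ :=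
    (dominatedFinMeasAdditive_cbmApplyMeasure m _).of_measure_le hle (norm_nonneg _)
  have h1 : scalarIntegral m f = setToFun μ _ hT f :=
    (setToFun_congr_measure_of_integrable 1 ENNReal.one_ne_top (by simpa using hle) hT _ f hf).symm
  rw [h1, setToFun_eq hT hf]
  generalize hf.toL1 f = u
  induction u using Lp.induction ENNReal.one_ne_top with
  | @indicatorConst c s hs hμs =>
    rw [L1.setToL1_simpleFunc_indicatorConst hT hs hμs, Lp.simpleFunc.coe_indicatorConst]
    have : indicatorConstLp 1 hs hμs.ne c = c • indicatorConstLp 1 hs hμs.ne (1 : 𝕜) := by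
      rw [indicatorConstLp, indicatorConstLp, ← MemLp.toLp_const_smul]
      congr 1
      ext x
      by_cases hx : x ∈ s <;> simp [hx]
    rw [this, map_smul, ← vectorMeasureOfL1_apply R hR hs]
    rfl
  | add hf hg _ h1 h2 => rw [map_add, map_add, h1, h2]
  | isClosed => exact isClosed_eq (ContinuousLinearMap.continuous _) R.continuous

end VectorMeasureOfL1

/-! ### Tensors as vector-valued functions on the dual ball -/

section DualBallEvaluation

variable {𝕜 : Type*} [RCLike 𝕜]
variable {E : Type*} [NormedAddCommGroup E] [NormedSpace 𝕜 E]
variable {F : Type*} [NormedAddCommGroup F] [NormedSpace 𝕜 F]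

instance : CompactSpace (DualBall 𝕜 E) :=
  isCompact_iff_compactSpace.1 (WeakDual.isCompact_closedBall (0 : StrongDual 𝕜 E) 1)

instance : T2Space (DualBall 𝕜 E) :=
  inferInstanceAs (T2Space (WeakDual.toStrongDual ⁻¹' Metric.closedBall (0 : StrongDual 𝕜 E) 1 :
    Set (WeakDual 𝕜 E)))

theorem DualBall.continuous_eval (e : E) : Continuous fun es : DualBall 𝕜 E => es.eval e :=
  (WeakDual.eval_continuous e).comp continuous_subtype_val

variable {G : Type*} [NormedAddCommGroup G] [NormedSpace 𝕜 G]

/-- The function `∑ e_i ⊗ y_i ↦ ∑ e*(e_i) y_i` on the algebraic tensor product. -/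
def DualBall.evalTensor (es : DualBall 𝕜 E) : E ⊗[𝕜] G →ₗ[𝕜] G :=
  TensorProduct.lift ((LinearMap.lsmul 𝕜 G) ∘ₗ (WeakDual.toStrongDual es.1 : E →ₗ[𝕜] 𝕜))

theorem DualBall.evalTensor_tmul (es : DualBall 𝕜 E) (e : E) (y : G) :
    es.evalTensor (e ⊗ₜ[𝕜] y) = es.eval e • y := rfl

theorem DualBall.continuous_evalTensor (t : E ⊗[𝕜] G) :
    Continuous fun es : DualBall 𝕜 E => es.evalTensor t := by
  induction t using TensorProduct.induction_on with
  | zero => simpa using continuous_const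
  | tmul e y =>
    simp only [DualBall.evalTensor_tmul]
    exact (DualBall.continuous_eval e).smul continuous_const
  | add s t hs ht =>
    simp only [map_add]
    exact hs.add ht

/-- Neither separability of G nor metrizability of the ball is available; measurability comes from
finite sums of scalar functions times fixed vectors. -/
theorem DualBall.stronglyMeasurable_evalTensor (t : E ⊗[𝕜] G) :
    StronglyMeasurable fun es : DualBall 𝕜 E => es.evalTensor t := by
  induction t using TensorProduct.induction_on with
  | zero => simpa using stronglyMeasurable_const
  | tmul e y =>
    simp only [DualBall.evalTensor_tmul]
    exact (DualBall.continuous_eval e).stronglyMeasurable.smul_const y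
  | add s t hs ht =>
    simp only [map_add]
    exact hs.add ht

theorem DualBall.apply_evalTensor (es : DualBall 𝕜 E) (ys : StrongDual 𝕜 G) (t : E ⊗[𝕜] G) :
    ys (es.evalTensor t) = pairFunctional 𝕜 E G (WeakDual.toStrongDual es.1) ys t := by
  induction t using TensorProduct.induction_on with
  | zero => simp
  | tmul e y =>
    rw [DualBall.evalTensor_tmul, pairFunctional_tmul, map_smul, smul_eq_mul]
    rfl
  | add s t hs ht => simp only [map_add, hs, ht]

/-- A norming functional on G attains the norm of the value. With the converse bound below, the
injective norm is the sup norm over the ball. -/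
theorem DualBall.norm_evalTensor_le (es : DualBall 𝕜 E) (t : E ⊗[𝕜] G) :
    ‖es.evalTensor t‖ ≤ injNorm 𝕜 E G t := by
  obtain ⟨ys, h1, h2⟩ := exists_dual_vector'' 𝕜 (es.evalTensor t)
  have := le_injNorm t (⟨WeakDual.toStrongDual es.1, es.2⟩, ⟨ys, mem_closedBall_zero_iff.2 h1⟩)
  rw [← DualBall.apply_evalTensor, h2] at this
  simpa using this

theorem injNorm_le_of_forall_norm_evalTensor_le {t : E ⊗[𝕜] G} {r : ℝ}
    (h : ∀ es : DualBall 𝕜 E, ‖es.evalTensor t‖ ≤ r) : injNorm 𝕜 E G t ≤ r := by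
  refine injNorm_le fun p => ?_
  let es : DualBall 𝕜 E := ⟨StrongDual.toWeakDual p.1.1, p.1.2⟩
  have h1 := DualBall.apply_evalTensor es p.2.1 t
  have h2 : ‖p.2.1‖ ≤ 1 := mem_closedBall_zero_iff.1 p.2.2
  calc _ = ‖p.2.1 (es.evalTensor t)‖ := by rw [h1]; rfl
    _ ≤ 1 * ‖es.evalTensor t‖ := p.2.1.le_of_opNorm_le h2 _
    _ ≤ r := by rw [one_mul]; exact h es

theorem DualBall.integrable_evalTensor (μ : Measure (DualBall 𝕜 E)) [IsFiniteMeasure μ]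
    (t : E ⊗[𝕜] G) : Integrable (fun es : DualBall 𝕜 E => es.evalTensor t) μ :=
  Integrable.of_bound (DualBall.stronglyMeasurable_evalTensor t).aestronglyMeasurable
    (injNorm 𝕜 E G t) (.of_forall fun es => es.norm_evalTensor_le t)

/-- The map sending `∑ e_i ⊗ y_i` to the class of `e* ↦ ∑ e*(e_i) y_i` in `L¹(μ; G)`. -/
def DualBall.evalTensorL1 (μ : Measure (DualBall 𝕜 E)) [IsFiniteMeasure μ] :
    E ⊗[𝕜] G →ₗ[𝕜] Lp G 1 μ where
  toFun t := (DualBall.integrable_evalTensor μ t).toL1 _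
  map_add' s t := by
    simp only [map_add]
    exact Integrable.toL1_add _ _ (DualBall.integrable_evalTensor μ s)
      (DualBall.integrable_evalTensor μ t)
  map_smul' c t := by
    simp only [map_smul]
    exact Integrable.toL1_smul' _ (DualBall.integrable_evalTensor μ t) c

theorem DualBall.norm_evalTensorL1 (μ : Measure (DualBall 𝕜 E)) [IsFiniteMeasure μ]
    (t : E ⊗[𝕜] G) : ‖DualBall.evalTensorL1 μ t‖ = ∫ es, ‖es.evalTensor t‖ ∂μ := by
  rw [L1.norm_eq_integral_norm]
  refine integral_congr_ae ?_
  filter_upwards [(DualBall.integrable_evalTensor μ t).coeFn_toL1] with es hes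
  exact congrArg norm hes

theorem DualBall.integrable_eval (μ : Measure (DualBall 𝕜 E)) [IsFiniteMeasure μ]
    (e : E) : Integrable (fun es : DualBall 𝕜 E => es.eval e) μ := by
  simpa [DualBall.evalTensor_tmul] using DualBall.integrable_evalTensor μ (e ⊗ₜ[𝕜] (1 : 𝕜))

end DualBallEvaluation

/-! ### Between induced functionals and representing measures -/

section InducedFunctional

variable {𝕜 : Type*} [RCLike 𝕜]
variable {E : Type*} [NormedAddCommGroup E] [NormedSpace 𝕜 E]
variable {F : Type*} [NormedAddCommGroup F] [NormedSpace 𝕜 F]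

/-- The linear form `e ⊗ y* ↦ y*(T e)` on the algebraic tensor product. -/
def tensorForm (T : E →L[𝕜] F) : E ⊗[𝕜] StrongDual 𝕜 F →ₗ[𝕜] 𝕜 :=
  TensorProduct.lift ((ContinuousLinearMap.coeLM 𝕜 ∘ₗ
    (NormedSpace.inclusionInDoubleDual 𝕜 F : F →ₗ[𝕜] _)) ∘ₗ (T : E →ₗ[𝕜] F))

theorem tensorForm_tmul (T : E →L[𝕜] F) (e : E) (ys : StrongDual 𝕜 F) :
    tensorForm T (e ⊗ₜ[𝕜] ys) = ys (T e) := rfl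

theorem exists_isInducedFunctional {T : E →L[𝕜] F} {C : ℝ} (hC : 0 ≤ C)
    (h : ∀ t, ‖tensorForm T t‖ ≤ C * injNorm 𝕜 E (StrongDual 𝕜 F) t) :
    ∃ φ, IsInducedFunctional T φ ∧ ‖φ‖ ≤ C := by
  let ψ : StrongDual 𝕜 (InjTensor 𝕜 E (StrongDual 𝕜 F)) :=
    LinearMap.mkContinuous (tensorForm T : InjTensor 𝕜 E (StrongDual 𝕜 F) →ₗ[𝕜] 𝕜) C h
  let c : InjTensor 𝕜 E (StrongDual 𝕜 F) →L[𝕜] InjTensorCompletion 𝕜 E (StrongDual 𝕜 F) :=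
    UniformSpace.Completion.toComplL
  have hφ : ∀ t : InjTensor 𝕜 E (StrongDual 𝕜 F), ψ.extend c t = ψ t := fun t =>
    ψ.extend_eq UniformSpace.Completion.denseRange_coe
      (UniformSpace.Completion.isUniformInducing_coe _) t
  refine ⟨ψ.extend c, fun e ys => hφ _, ?_⟩
  refine ContinuousLinearMap.opNorm_le_bound _ hC fun z => ?_
  refine UniformSpace.Completion.induction_on z
    (isClosed_le (by fun_prop) (by fun_prop)) fun t => ?_
  rw [hφ, UniformSpace.Completion.norm_coe]
  exact h t

theorem IsInducedFunctional.norm_tensorForm_le {T : E →L[𝕜] F}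
    {φ : StrongDual 𝕜 (InjTensorCompletion 𝕜 E (StrongDual 𝕜 F))} (hφ : IsInducedFunctional T φ)
    (t : E ⊗[𝕜] StrongDual 𝕜 F) :
    ‖tensorForm T t‖ ≤ ‖φ‖ * injNorm 𝕜 E (StrongDual 𝕜 F) t := by
  let c : InjTensor 𝕜 E (StrongDual 𝕜 F) →L[𝕜] InjTensorCompletion 𝕜 E (StrongDual 𝕜 F) :=
    UniformSpace.Completion.toComplL
  have h : ∀ t, tensorForm T t = (φ ∘L c) t := fun t => by
    induction t using TensorProduct.induction_on with
    | zero => exact (map_zero _).trans (map_zero (φ ∘L c)).symm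
    | tmul e ys => exact (hφ e ys).symm
    | add s t hs ht =>
      exact (map_add _ s t).trans ((congrArg₂ (· + ·) hs ht).trans (map_add (φ ∘L c) s t).symm)
  rw [h]
  refine (φ.le_opNorm _).trans_eq ?_
  congr 1
  exact UniformSpace.Completion.norm_coe (E := InjTensor 𝕜 E (StrongDual 𝕜 F)) t

/-- The duality pairing of a space and its dual, as a real bilinear map. -/
def realDualPairing (𝕜 G : Type*) [RCLike 𝕜] [NormedAddCommGroup G] [NormedSpace 𝕜 G]
    [NormedSpace ℝ G] [IsScalarTower ℝ 𝕜 G] : G →L[ℝ] StrongDual 𝕜 G →L[ℝ] 𝕜 :=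
  (ContinuousLinearMap.apply 𝕜 𝕜 : G →L[𝕜] StrongDual 𝕜 G →L[𝕜] 𝕜).bilinearRestrictScalars ℝ

theorem norm_integral_bilinearRestrictScalars_le {X : Type*} [MeasurableSpace X]
    {G H : Type*} [NormedAddCommGroup G] [NormedSpace 𝕜 G] [NormedSpace ℝ G] [IsScalarTower ℝ 𝕜 G]
    [NormedAddCommGroup H] [NormedSpace 𝕜 H] [NormedSpace ℝ H] [IsScalarTower ℝ 𝕜 H]
    (m : NormedVectorMeasure X H) [IsFiniteMeasure m.variation] (B : G →L[𝕜] H →L[𝕜] 𝕜)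
    (hB : ‖B‖ ≤ 1) {f : X → G} {r : ℝ} (hr : 0 ≤ r) (hf : ∀ x, ‖f x‖ ≤ r) :
    ‖m.integral f (B.bilinearRestrictScalars ℝ)‖ ≤ m.variation.real univ * r := by
  have hB' : ‖B.bilinearRestrictScalars ℝ‖ ≤ 1 :=
    ContinuousLinearMap.opNorm_le_bound₂ _ zero_le_one fun x y =>
      (B.le_of_opNorm₂_le_of_le hB le_rfl le_rfl).trans_eq (by ring)
  calc _ ≤ r * ‖B.bilinearRestrictScalars ℝ‖ * m.variation.real univ :=
      VectorMeasure.norm_integral_le_of_norm_le_const (.of_forall hf)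
    _ ≤ r * 1 * m.variation.real univ := by gcongr
    _ = _ := by rw [mul_one, mul_comm]

theorem norm_integral_realDualPairing_le {X : Type*} [MeasurableSpace X] {G : Type*}
    [NormedAddCommGroup G] [NormedSpace 𝕜 G] [NormedSpace ℝ G] [IsScalarTower ℝ 𝕜 G]
    (m : NormedVectorMeasure X (StrongDual 𝕜 G)) [IsFiniteMeasure m.variation] {f : X → G} {r : ℝ}
    (hr : 0 ≤ r) (hf : ∀ x, ‖f x‖ ≤ r) :
    ‖m.integral f (realDualPairing 𝕜 G)‖ ≤ m.variation.real univ * r := by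
  refine norm_integral_bilinearRestrictScalars_le m (ContinuousLinearMap.apply 𝕜 𝕜) ?_ hr hf
  refine ContinuousLinearMap.opNorm_le_bound₂ _ zero_le_one fun x f => ?_
  rw [one_mul, mul_comm]
  exact f.le_opNorm x

/-- Evaluation at y and the map c ↦ c • y both pass through the integral, and turn the two sides
into the integral of f for the same bilinear map. -/
theorem scalarIntegral_apply {X : Type*} [MeasurableSpace X] {G : Type*} [NormedAddCommGroup G]
    [NormedSpace 𝕜 G] [NormedSpace ℝ G] [IsScalarTower ℝ 𝕜 G]
    (m : NormedVectorMeasure X (StrongDual 𝕜 G)) {f : X → 𝕜} (hf : Integrable f m.variation)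
    (y : G) : scalarIntegral m f y = m.integral (fun x => f x • y) (realDualPairing 𝕜 G) := by
  have h1 := VectorMeasure.continuousLinearMap_apply_integral
    (B := ContinuousLinearMap.lsmul ℝ 𝕜 (E := StrongDual 𝕜 G)) (C := realDualPairing 𝕜 G y) hf
  have h2 := VectorMeasure.integral_continuousLinearMap_comp (B := realDualPairing 𝕜 G)
    (C := (ContinuousLinearMap.toSpanSingleton 𝕜 y).restrictScalars ℝ) hf
  refine h1.trans (Eq.trans ?_ h2.symm)
  congr 1
  ext c z
  simp [realDualPairing]

/-- Writing the form as a single integral of a vector-valued function lets the sup norm of the whole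
tensor enter the estimate, not a sum over its terms. -/
theorem Represents.tensorForm_eq {T : E →L[𝕜] F}
    {m : NormedVectorMeasure (DualBall 𝕜 E) (StrongDual 𝕜 (StrongDual 𝕜 F))}
    (hm : Represents m T) [IsFiniteMeasure m.variation] (t : E ⊗[𝕜] StrongDual 𝕜 F) :
    tensorForm T t = m.integral (fun es => es.evalTensor t)
      (realDualPairing 𝕜 (StrongDual 𝕜 F)) := by
  induction t using TensorProduct.induction_on with
  | zero => simp
  | tmul e ys =>
    rw [tensorForm_tmul, ← NormedSpace.dual_def, hm e,
      scalarIntegral_apply m (DualBall.integrable_eval _ e)]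
    rfl
  | add s t hs ht =>
    simp only [map_add, hs, ht]
    exact (VectorMeasure.integral_fun_add (DualBall.integrable_evalTensor _ s)
      (DualBall.integrable_evalTensor _ t)).symm

theorem Represents.norm_tensorForm_le {T : E →L[𝕜] F}
    {m : NormedVectorMeasure (DualBall 𝕜 E) (StrongDual 𝕜 (StrongDual 𝕜 F))}
    (hm : Represents m T) (hbv : HasBoundedVariation m) (t : E ⊗[𝕜] StrongDual 𝕜 F) :
    ‖tensorForm T t‖ ≤ (totalVariation m).toReal * injNorm 𝕜 E (StrongDual 𝕜 F) t := by
  have : IsFiniteMeasure m.variation := ⟨hbv⟩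
  rw [hm.tensorForm_eq]
  exact norm_integral_realDualPairing_le m (Real.iSup_nonneg fun _ => norm_nonneg _)
    fun es => es.norm_evalTensor_le t

theorem IsInducedFunctional.exists_regular_measure {T : E →L[𝕜] F}
    {φ : StrongDual 𝕜 (InjTensorCompletion 𝕜 E (StrongDual 𝕜 F))} (hφ : IsInducedFunctional T φ) :
    ∃ μ : Measure (DualBall 𝕜 E), μ.Regular ∧ IsFiniteMeasure μ ∧ μ univ ≤ ENNReal.ofReal ‖φ‖ ∧
      ∀ t, ‖tensorForm T t‖ ≤ ∫ es, ‖es.evalTensor t‖ ∂μ := by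
  let : Module ℝ (E ⊗[𝕜] StrongDual 𝕜 F) := Module.restrictScalars ℝ 𝕜 _
  have : IsScalarTower ℝ 𝕜 (E ⊗[𝕜] StrongDual 𝕜 F) := IsScalarTower.restrictScalars _ _ _
  obtain ⟨μ, h1, h2, h3, h4⟩ := exists_regular_measure_le_integral
    (fun (t : E ⊗[𝕜] StrongDual 𝕜 F) (es : DualBall 𝕜 E) => ‖es.evalTensor t‖)
    (fun t => (DualBall.continuous_evalTensor t).norm)
    (fun s t es => by rw [map_add]; exact norm_add_le _ _)
    (fun c hc t es => by
      rw [← algebraMap_smul 𝕜 c t, map_smul, norm_smul]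
      simp [abs_of_nonneg hc])
    (RCLike.reLm ∘ₗ (tensorForm T).restrictScalars ℝ) (C := ‖φ‖) (fun t r hr ht => by
      refine (RCLike.re_le_norm _).trans ((hφ.norm_tensorForm_le t).trans ?_)
      gcongr
      exact injNorm_le_of_forall_norm_evalTensor_le ht)
  refine ⟨μ, h1, h2, h3, fun t => ?_⟩
  -- Domination only controls the real part; a unimodular factor makes the form equal to its modulus
  -- and leaves the integrand unchanged.
  obtain ⟨c, hc, hct⟩ := RCLike.exists_norm_eq_mul_self (tensorForm T t)
  have h := h4 (c • t)
  have e : ∀ es : DualBall 𝕜 E, ‖es.evalTensor (c • t)‖ = ‖es.evalTensor t‖ := fun es => by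
    rw [map_smul, norm_smul, hc, one_mul]
  simp only [e] at h
  refine le_trans (le_of_eq ?_) h
  simp [← hct]

/-- A functional on `L¹(μ; G)` as an operator from `L¹(μ)` to the dual of `G`. -/
def dualOfL1 {X : Type*} [MeasurableSpace X] {μ : Measure X} {G : Type*} [NormedAddCommGroup G]
    [NormedSpace 𝕜 G] (Ψ : StrongDual 𝕜 (Lp G 1 μ)) : Lp 𝕜 1 μ →L[𝕜] StrongDual 𝕜 G :=
  (ContinuousLinearMap.compL 𝕜 (Lp 𝕜 1 μ) (Lp G 1 μ) 𝕜 Ψ ∘L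
    ContinuousLinearMap.compLpL₂ 1 μ (ContinuousLinearMap.lsmul 𝕜 𝕜 (E := G)).flip).flip

section

variable {X : Type*} [MeasurableSpace X] {μ : Measure X} {G : Type*} [NormedAddCommGroup G]
    [NormedSpace 𝕜 G] (Ψ : StrongDual 𝕜 (Lp G 1 μ))

theorem dualOfL1_apply (f : Lp 𝕜 1 μ) (y : G) : dualOfL1 Ψ f y =
    Ψ (((ContinuousLinearMap.lsmul 𝕜 𝕜 (E := G)).flip y).compLp f) := rfl

theorem norm_dualOfL1_le : ‖dualOfL1 Ψ‖ ≤ ‖Ψ‖ := by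
  refine ContinuousLinearMap.opNorm_le_bound₂ _ (norm_nonneg _) fun f y => ?_
  rw [dualOfL1_apply, mul_assoc]
  refine (Ψ.le_opNorm _).trans ?_
  gcongr
  refine (ContinuousLinearMap.norm_compLp_le _ f).trans ?_
  rw [mul_comm]
  gcongr
  refine ContinuousLinearMap.opNorm_le_bound _ (norm_nonneg _) fun c => ?_
  simp [norm_smul, mul_comm]

end

theorem scalarIntegral_vectorMeasureOfL1_dualOfL1 {μ : Measure (DualBall 𝕜 E)}
    [IsFiniteMeasure μ] {G : Type*} [NormedAddCommGroup G] [NormedSpace 𝕜 G]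
    (Ψ : StrongDual 𝕜 (Lp G 1 μ)) (hR : ‖dualOfL1 Ψ‖ ≤ 1) (e : E) (y : G) :
    scalarIntegral (vectorMeasureOfL1 (dualOfL1 Ψ) hR) (fun es : DualBall 𝕜 E => es.eval e) y =
      Ψ (DualBall.evalTensorL1 μ (e ⊗ₜ[𝕜] y)) := by
  rw [scalarIntegral_vectorMeasureOfL1 _ hR (DualBall.integrable_eval μ e), dualOfL1_apply]
  congr 1

/-- The hypothesis says that ψ is dominated by the L¹(μ; G) norm, so it extends to a functional
there of norm at most one, hence gives a contraction from L¹(μ) to the dual of G. -/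
theorem exists_vectorMeasure_of_norm_le_integral {μ : Measure (DualBall 𝕜 E)} [μ.Regular]
    [IsFiniteMeasure μ] {G : Type*} [NormedAddCommGroup G] [NormedSpace 𝕜 G]
    (ψ : E ⊗[𝕜] G →ₗ[𝕜] 𝕜) (h : ∀ t, ‖ψ t‖ ≤ ∫ es, ‖es.evalTensor t‖ ∂μ) :
    ∃ m : NormedVectorMeasure (DualBall 𝕜 E) (StrongDual 𝕜 G),
      IsRegularVectorMeasure m ∧ totalVariation m ≤ μ univ ∧
      ∀ e y, scalarIntegral m (fun es : DualBall 𝕜 E => es.eval e) y = ψ (e ⊗ₜ[𝕜] y) := by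
  obtain ⟨Ψ, hΨ, hΨJ⟩ := exists_dual_comp_eq (DualBall.evalTensorL1 μ) ψ fun t =>
    (h t).trans_eq (DualBall.norm_evalTensorL1 μ t).symm
  have hR := (norm_dualOfL1_le Ψ).trans hΨ
  have hvar := variation_vectorMeasureOfL1_le (dualOfL1 Ψ) hR
  refine ⟨vectorMeasureOfL1 (dualOfL1 Ψ) hR, isRegularVectorMeasure_of_variation_le hvar,
    hvar univ, fun e y => ?_⟩
  rw [scalarIntegral_vectorMeasureOfL1_dualOfL1, hΨJ]

theorem IsInducedFunctional.exists_vectorMeasure {T : E →L[𝕜] F}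
    {φ : StrongDual 𝕜 (InjTensorCompletion 𝕜 E (StrongDual 𝕜 F))} (hφ : IsInducedFunctional T φ) :
    ∃ m : NormedVectorMeasure (DualBall 𝕜 E) (StrongDual 𝕜 (StrongDual 𝕜 F)),
      IsRegularVectorMeasure m ∧ totalVariation m ≤ ENNReal.ofReal ‖φ‖ ∧ Represents m T := by
  obtain ⟨μ, _, _, hμ, hT⟩ := hφ.exists_regular_measure
  obtain ⟨m, h1, h2, h3⟩ := exists_vectorMeasure_of_norm_le_integral (tensorForm T) hT
  refine ⟨m, h1, h2.trans hμ, fun e => ?_⟩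
  ext ys
  exact (h3 e ys).symm

end InducedFunctional

end GrothendieckIntegral

end

theorem proposition1 {𝕜 : Type*} [RCLike 𝕜]
    {E : Type*} [NormedAddCommGroup E] [NormedSpace 𝕜 E] [CompleteSpace E]
    {F : Type*} [NormedAddCommGroup F] [NormedSpace 𝕜 F] [CompleteSpace F]
    (T : E →L[𝕜] F) :
    (GrothendieckIntegral.IsIntegralOperator T ↔
      ∃ m : GrothendieckIntegral.NormedVectorMeasure (GrothendieckIntegral.DualBall 𝕜 E)
          (StrongDual 𝕜 (StrongDual 𝕜 F)),
        GrothendieckIntegral.IsRegularVectorMeasure m ∧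
        GrothendieckIntegral.HasBoundedVariation m ∧
        GrothendieckIntegral.Represents m T) ∧
    (∀ hT : GrothendieckIntegral.IsIntegralOperator T,
      ∃ m : GrothendieckIntegral.NormedVectorMeasure (GrothendieckIntegral.DualBall 𝕜 E)
          (StrongDual 𝕜 (StrongDual 𝕜 F)),
        GrothendieckIntegral.IsRegularVectorMeasure m ∧
        GrothendieckIntegral.HasBoundedVariation m ∧
        GrothendieckIntegral.Represents m T ∧
        GrothendieckIntegral.totalVariation m =
           ENNReal.ofReal (GrothendieckIntegral.integralNorm T hT)) := by
  open GrothendieckIntegral in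
  refine ⟨⟨?_, ?_⟩, fun hT => ?_⟩
  · rintro ⟨φ, hφ⟩
    obtain ⟨m, h1, h2, h3⟩ := hφ.exists_vectorMeasure
    exact ⟨m, h1, h2.trans_lt ENNReal.ofReal_lt_top, h3⟩
  · rintro ⟨m, -, hbv, hm⟩
    obtain ⟨φ, hφ, -⟩ := exists_isInducedFunctional ENNReal.toReal_nonneg
      (hm.norm_tensorForm_le hbv)
    exact ⟨φ, hφ⟩
  · obtain ⟨φ, hφ⟩ := id hT
    obtain ⟨m, h1, h2, h3⟩ := hφ.exists_vectorMeasure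
    have hbv : HasBoundedVariation m := h2.trans_lt ENNReal.ofReal_lt_top
    refine ⟨m, h1, hbv, h3, ?_⟩
    -- The converse direction applied to this m gives an induced functional of norm at most
    -- |m|(B(E*)); by uniqueness it is φ, so the variation cannot be smaller than ‖φ‖.
    obtain ⟨ψ, hψ, hle⟩ := exists_isInducedFunctional ENNReal.toReal_nonneg
      (h3.norm_tensorForm_le hbv)
    rw [integralNorm_eq _ hφ]
    refine le_antisymm h2 ?_
    rw [hφ.unique hψ]
    exact ENNReal.ofReal_le_of_le_toReal hle
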